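/- Let $\mathcal H$ be a real Hilbert space. Let $f:\mathcal H\to\mathbb R$ be a differentiable function which is bounded below and whose gradient $\nabla f$ is Lipschitz continuous on every bounded subset of $\mathcal H$. For $\phi:\mathcal H\to\mathbb R$ let $\partial\phi(u)=\{p\in\mathcal H:\ \phi(w)\ge \phi(u)+\langle p,w-u\rangle\ \text{for all } w\in\mathcal H\}$ denote its convex subdifferential. Let $\phi$ be a damping potential, that is: $\phi$ is nonnegative, convex and continuous; $\phi(0)=0=\min_{\mathcal H}\phi$; and for every $R>0$ one has $\sup_{\|u\|\le R}\|(\partial\phi)^0(u)\|<+\infty$, where $(\partial\phi)^0(u)$ is the element of minimal norm of the nonempty closed convex set $\partial\phi(u)$. Then for all $x_0,x_1\in\mathcal H$ there is a unique function $x:[0,+\infty)\to\mathcal H$ which satisfies $x(0)=x_0$, $\dot x(0)=x_1$ and is a strong global solution of $$0\in\ddot x(t)+\partial\phi(\dot x(t))+\nabla f(x(t)),$$ that is: (i) $x\in C^1([0,+\infty);\mathcal H)$; (ii) for every $T>0$, $\dot x$ is Lipschitz continuous on $[0,T]$ and $\ddot x\in L^\infty(0,T;\mathcal H)$; (iii)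 for almost every $t>0$, $\dot x$ is differentiable at $t$, with derivative $\ddot x(t)$, and $0\in\ddot x(t)+\partial\phi(\dot x(t))+\nabla f(x(t))$. -/

import Mathlib

open Set MeasureTheory
open scoped Pointwise

/-- The convex subdifferential `∂φ(u)` of a real-valued function on a Hilbert space. -/
def subdifferential {H : Type*} [NormedAddCommGroup H] [InnerProductSpace ℝ H]
    (φ : H → ℝ) (u : H) : Set H :=
  {p | ∀ w, φ u + inner ℝ p (w - u) ≤ φ w}

theorem isClosed_subdifferential {H : Type*} [NormedAddCommGroup H] [InnerProductSpace ℝ H]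
    (φ : H → ℝ) (u : H) : IsClosed (subdifferential φ u) := by
  simp only [subdifferential, Set.ofPred_forall]
  exact isClosed_iInter fun w => isClosed_le (by fun_prop) (by fun_prop)

theorem convex_subdifferential {H : Type*} [NormedAddCommGroup H] [InnerProductSpace ℝ H]
    (φ : H → ℝ) (u : H) : Convex ℝ (subdifferential φ u) := by
  intro p hp q hq a b ha hb hab w
  rw [inner_add_left, real_inner_smul_left, real_inner_smul_left]
  have h1 := mul_le_mul_of_nonneg_left (hp w) ha
  have h2 := mul_le_mul_of_nonneg_left (hq w) hb
  have hb' : b = 1 - a := by linarith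
  subst hb'
  nlinarith

/-- A continuous convex function on a Hilbert space is subdifferentiable everywhere. -/
theorem subdifferential_nonempty {H : Type*} [NormedAddCommGroup H] [InnerProductSpace ℝ H]
    [CompleteSpace H] {φ : H → ℝ} (hconv : ConvexOn ℝ univ φ) (hcont : Continuous φ) (u : H) :
    (subdifferential φ u).Nonempty := by
  have hS : Convex ℝ {z : H × ℝ | z.1 ∈ univ ∧ φ z.1 < z.2} := hconv.convex_strict_epigraph
  have hO : IsOpen {z : H × ℝ | z.1 ∈ univ ∧ φ z.1 < z.2} := by
    simp only [mem_univ, true_and]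
    exact isOpen_lt (by fun_prop) (by fun_prop)
  obtain ⟨L, hL⟩ := geometric_hahn_banach_open_point (x := (u, φ u)) hS hO (by simp)
  have key : ∀ w r, L (w, r) = L (w, 0) + r * L (0, 1) := by
    intro w r
    have : ((w, r) : H × ℝ) = (w, 0) + r • (0, 1) := by simp
    rw [this, map_add, map_smul, smul_eq_mul]
  have hc : L (0, 1) < 0 := by
    have := hL (u, φ u + 1) ⟨mem_univ _, by simp⟩
    rw [key u (φ u + 1), key u (φ u)] at this
    linarith
  have hle : ∀ w, L (w, 0) + φ w * L (0, 1) ≤ L (u, 0) + φ u * L (0, 1) := by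
    intro w
    refine le_of_forall_pos_le_add fun ε hε => ?_
    have := hL (w, φ w + ε / (-L (0, 1)))
      ⟨mem_univ _, by have : 0 < ε / (-L (0, 1)) := div_pos hε (by linarith)
                      simpa using this⟩
    rw [key w, key u] at this
    have h2 : ε / (-L (0, 1)) * L (0, 1) = -ε := by
      have hne : -(L (0, 1)) ≠ 0 := by linarith
      have := div_mul_cancel₀ ε hne
      linarith
    nlinarith
  let l : H →L[ℝ] ℝ := (-(L (0, 1)))⁻¹ • (L.comp (ContinuousLinearMap.inl ℝ H ℝ))
  refine ⟨(InnerProductSpace.toDual ℝ H).symm l, fun w => ?_⟩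
  rw [InnerProductSpace.toDual_symm_apply]
  have hl : l (w - u) = (-(L (0, 1)))⁻¹ * (L (w, 0) - L (u, 0)) := by
    simp only [l, smul_apply, ContinuousLinearMap.comp_apply,
      ContinuousLinearMap.inl_apply, smul_eq_mul, map_sub]
    ring
  have hpos : 0 < (-(L (0, 1)))⁻¹ := inv_pos.2 (by linarith)
  have hmul : (-(L (0, 1)))⁻¹ * (-(L (0, 1))) = 1 := inv_mul_cancel₀ (by linarith)
  rw [hl]
  have := mul_le_mul_of_nonneg_left (hle w) hpos.le
  linear_combination this + (φ w - φ u) * hmul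

open Classical in
/-- The minimal section `(∂φ)⁰(u)`: the element of minimal norm of `∂φ(u)`. -/
noncomputable def minimalSection {H : Type*} [NormedAddCommGroup H] [InnerProductSpace ℝ H]
    (φ : H → ℝ) (u : H) : H :=
  if h : ∃ p ∈ subdifferential φ u, ∀ q ∈ subdifferential φ u, ‖p‖ ≤ ‖q‖ then h.choose else 0

/-- For a continuous convex function, `minimalSection φ u` really is an element of minimal norm
of `∂φ(u)` (so the default value in its definition is never used). -/
theorem minimalSection_spec {H : Type*} [NormedAddCommGroup H] [InnerProductSpace ℝ H]
    [CompleteSpace H] {φ : H → ℝ} (hconv : ConvexOn ℝ univ φ) (hcont : Continuous φ) (u : H) :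
    minimalSection φ u ∈ subdifferential φ u ∧
      ∀ q ∈ subdifferential φ u, ‖minimalSection φ u‖ ≤ ‖q‖ := by
  have h : ∃ p ∈ subdifferential φ u, ∀ q ∈ subdifferential φ u, ‖p‖ ≤ ‖q‖ := by
    obtain ⟨p, hp, hmin⟩ := exists_norm_eq_iInf_of_complete_convex
      (subdifferential_nonempty hconv hcont u) (isClosed_subdifferential φ u).isComplete
      (convex_subdifferential φ u) 0
    refine ⟨p, hp, fun q hq => ?_⟩
    have h1 : ‖(0 : H) - p‖ ≤ ‖(0 : H) - q‖ := by
      rw [hmin]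
      exact ciInf_le (f := fun w : subdifferential φ u => ‖(0 : H) - w‖)
        ⟨0, by rintro _ ⟨w, rfl⟩; exact norm_nonneg _⟩ ⟨q, hq⟩
    simpa using h1
  rw [minimalSection, dif_pos h]
  exact h.choose_spec

/-- Damping potentials: nonnegative, convex, continuous functions vanishing at the origin
(which is then a minimizer), whose subdifferential has a minimal section that is bounded on
bounded sets. -/
structure IsDampingPotential {H : Type*} [NormedAddCommGroup H] [InnerProductSpace ℝ H]
    (φ : H → ℝ) : Prop where
  nonneg : ∀ u, 0 ≤ φ u
  convex : ConvexOn ℝ univ φ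
  continuous : Continuous φ
  map_zero : φ 0 = 0
  minimalSection_bounded : ∀ R > 0, ∃ M : ℝ, ∀ u, ‖u‖ ≤ R → ‖minimalSection φ u‖ ≤ M

/-- The velocity of a trajectory on `[0, ∞)` (one-sided derivative at `0`). -/
noncomputable def velocity {H : Type*} [NormedAddCommGroup H] [InnerProductSpace ℝ H]
    (x : ℝ → H) : ℝ → H :=
  derivWithin x (Ici 0)

/-- The acceleration of a trajectory; only its values at a.e. `t > 0` are used. -/
noncomputable def acceleration {H : Type*} [NormedAddCommGroup H] [InnerProductSpace ℝ H]
    (x : ℝ → H) : ℝ → H :=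
  deriv (velocity x)

/-- `x`, of which only the restriction to `[0, ∞)` matters, is a strong global solution of
`0 ∈ x'' + ∂φ(x') + ∇f(x)`. -/
structure IsStrongGlobalSolution {H : Type*} [NormedAddCommGroup H] [InnerProductSpace ℝ H]
    [CompleteSpace H] (φ f : H → ℝ) (x : ℝ → H) : Prop where
  contDiffOn : ContDiffOn ℝ 1 x (Ici 0)
  lipschitz_velocity : ∀ T > 0, ∃ L, LipschitzOnWith L (velocity x) (Icc 0 T)
  memLp_acceleration : ∀ T > 0, MemLp (acceleration x) ⊤ (volume.restrict (Ioo 0 T))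
  inclusion : ∀ᵐ t ∂(volume.restrict (Ioi (0 : ℝ))), DifferentiableAt ℝ (velocity x) t ∧
    (0 : H) ∈ ({acceleration x t} : Set H) + subdifferential φ (velocity x t) + {gradient f (x t)}

/-! In the phase space of pairs z = (v, x) with the Hilbert norm, the equation reads z' + ∂Ψ(z) ∋
B(z) with Ψ(v, x) = φ(v) and B(v, x) = (-∇f(x), v). The field B is Lipschitz on bounded sets and ∂Ψ
is monotone, so B - ∂Ψ is one-sided Lipschitz there, and Gronwall gives uniqueness
(`IsSolutionOn.unique`).

For existence, truncation outside a ball makes B globally Lipschitz and bounded and Ψ globally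
Lipschitz; the bound on the minimal section enters here (`exists_lipschitz_convex_minorant`).
Explicit Euler polygons for any section F of the truncated B - ∂Ψ are then equi-Lipschitz, and the
one-sided estimate makes them Cauchy as the step tends to 0. Their limit is Lipschitz, hence a.e.
differentiable. The inclusion survives because it can be tested by the growth of ‖z - w‖², which
needs no convergence of derivatives (`mem_subdifferential_of_tendsto_approx`).

The energy ‖v‖² + 2f(x) is nonincreasing and f is bounded below, so v stays bounded and x grows at
most linearly (`IsSolutionOn.norm_le`). On [0, T] a large enough ball is therefore never left, the
truncation is invisible, and uniqueness glues these solutions into a global one. -/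

/-! ### Scalar inequalities for absolutely continuous functions. -/

/-- An absolutely continuous function whose derivative is a.e. at most `c` grows at rate at
most `c`. -/
theorem AbsolutelyContinuousOnInterval.sub_le_of_ae_deriv_le {g : ℝ → ℝ} {a b c : ℝ} (hab : a ≤ b)
    (hg : AbsolutelyContinuousOnInterval g a b)
    (h : ∀ᵐ t, t ∈ Ioo a b → deriv g t ≤ c) : g b - g a ≤ c * (b - a) := by
  rw [← hg.integral_deriv_eq_sub]
  have h2 : ∀ᵐ t ∂(volume.restrict (Icc a b)), deriv g t ≤ c := by
    rw [← restrict_Ioo_eq_restrict_Icc, ae_restrict_iff' measurableSet_Ioo]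
    exact h
  have h3 := intervalIntegral.integral_mono_ae_restrict hab hg.intervalIntegrable_deriv
    (intervalIntegrable_const (c := c)) h2
  simpa [mul_comm] using h3

/-- Gronwall's inequality for absolutely continuous functions. -/
theorem AbsolutelyContinuousOnInterval.gronwall {g : ℝ → ℝ} {T C δ : ℝ} (hT : 0 ≤ T) (hC : 0 < C)
    (hδ : 0 ≤ δ)
    (hg : AbsolutelyContinuousOnInterval g 0 T)
    (h : ∀ᵐ t, t ∈ Ioo 0 T → deriv g t ≤ C * g t + δ) :
    g T ≤ Real.exp (C * T) * (g 0 + δ / C) := by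
  have hexp : AbsolutelyContinuousOnInterval (fun t => Real.exp (-(C * t))) 0 T :=
    ContDiffOn.absolutelyContinuousOnInterval (by fun_prop)
  have hconst : AbsolutelyContinuousOnInterval (fun _ : ℝ => δ / C) 0 T :=
    ContDiffOn.absolutelyContinuousOnInterval (by fun_prop)
  -- Adding δ/C absorbs the error: exp(-Ct)(g + δ/C) is nonincreasing.
  have hW := hexp.fun_mul (hg.fun_add hconst)
  have h1 := hW.sub_le_of_ae_deriv_le hT (c := 0) (by
    filter_upwards [h, hg.ae_differentiableAt] with t ht hd htT
    have hd' := (hd (by rw [uIcc_of_le hT]; exact Ioo_subset_Icc_self htT)).hasDerivAt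
    have he : HasDerivAt (fun t => Real.exp (-(C * t))) (Real.exp (-(C * t)) * (-(C * 1))) t :=
      (((hasDerivAt_id t).const_mul C).neg).exp
    have hp := he.mul (hd'.add_const (δ / C))
    have hpd : deriv (fun x => Real.exp (-(C * x)) * (g x + δ / C)) t = _ := hp.deriv
    rw [hpd]
    have h3 := ht htT
    have h4 : C * (δ / C) = δ := by field_simp
    have h5 := Real.exp_pos (-(C * t))
    have : Real.exp (-(C * t)) * -(C * 1) * (g t + δ / C) + Real.exp (-(C * t)) * deriv g t
      = Real.exp (-(C * t)) * (deriv g t - C * g t - C * (δ / C)) := by ring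
    rw [this, h4]
    exact mul_nonpos_of_nonneg_of_nonpos h5.le (by linarith))
  have h2 : Real.exp (-(C * T)) * (g T + δ / C) ≤ g 0 + δ / C := by
    simpa using h1
  have h3 := mul_le_mul_of_nonneg_left h2 (Real.exp_pos (C * T)).le
  rw [← mul_assoc, ← Real.exp_add] at h3
  simp only [add_neg_cancel, Real.exp_zero, one_mul] at h3
  linarith [div_nonneg hδ hC.le]

theorem LipschitzOnWith.absolutelyContinuousOnInterval_norm_sq {E : Type*}
    [NormedAddCommGroup E] {u : ℝ → E} {a b : ℝ} {K : NNReal}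
    (hu : LipschitzOnWith K u (uIcc a b)) :
    AbsolutelyContinuousOnInterval (fun t => ‖u t‖ ^ 2) a b := by
  have h : LipschitzOnWith (1 * K) (fun t => ‖u t‖) (uIcc a b) :=
    lipschitzWith_one_norm.comp_lipschitzOnWith hu
  simpa [pow_two] using
    h.absolutelyContinuousOnInterval.fun_mul h.absolutelyContinuousOnInterval

/-! ### Lipschitz curves in a Hilbert space. -/

section
variable {E : Type*} [NormedAddCommGroup E] [InnerProductSpace ℝ E]

/-- Mean value inequality for Lipschitz curves with a.e. bounded derivative. -/
theorem LipschitzOnWith.norm_sub_le_of_ae_norm_deriv_le {u : ℝ → E} {a b V : ℝ} {K : NNReal}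
    (hab : a ≤ b) (hV : 0 ≤ V) (hu : LipschitzOnWith K u (Icc a b))
    (h : ∀ᵐ t, t ∈ Ioo a b → DifferentiableAt ℝ u t ∧ ‖deriv u t‖ ≤ V) :
    ‖u b - u a‖ ≤ V * (b - a) := by
  -- Pairing with the increment itself reduces the claim to a scalar function.
  set e := u b - u a with he
  have h1 : LipschitzOnWith _ (fun t => inner ℝ e (u t)) (uIcc a b) :=
    (innerSL ℝ e).lipschitz.comp_lipschitzOnWith (by rwa [uIcc_of_le hab])
  have h2 := h1.absolutelyContinuousOnInterval.sub_le_of_ae_deriv_le hab (c := ‖e‖ * V) (by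
    filter_upwards [h] with t ht htI
    obtain ⟨hd, hdV⟩ := ht htI
    have h3 : HasDerivAt (fun t => inner ℝ e (u t)) (inner ℝ e (deriv u t)) t :=
      (innerSL ℝ e).hasFDerivAt.comp_hasDerivAt t hd.hasDerivAt
    rw [h3.deriv]
    exact (real_inner_le_norm _ _).trans (by gcongr))
  rw [← inner_sub_right, ← he, real_inner_self_eq_norm_sq] at h2
  rcases (norm_nonneg e).eq_or_lt with h0 | h0
  · nlinarith [mul_nonneg hV (sub_nonneg.2 hab)]
  · nlinarith

variable [CompleteSpace E]

/-- Lipschitz curves in a Hilbert space are a.e. differentiable. -/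
theorem LipschitzWith.ae_differentiableAt_of_hilbert_Ioo {v : ℝ → E} {L : NNReal}
    (hv : LipschitzWith L v) {a b : ℝ} (hab : a ≤ b) :
    ∀ᵐ t, t ∈ Ioo a b → DifferentiableAt ℝ v t := by
  let μ : Measure ℝ := volume.restrict (Ioc a b)
  -- The difference quotients are bounded in L²; a weak limit g satisfies v(t) = v(a) + ∫ g, and
  -- Lebesgue differentiation concludes.
  let D : ℕ → ℝ → E := fun n t => ((n : ℝ) + 1) • (v (t + 1 / ((n : ℝ) + 1)) - v t)
  have hvc : Continuous v := hv.continuous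
  have hDc : ∀ n, Continuous (D n) := fun n => by
    simp only [D]; fun_prop
  have hDb : ∀ n t, ‖D n t‖ ≤ L := fun n t => by
    have hn : (0 : ℝ) < (n : ℝ) + 1 := by positivity
    have h := hv.norm_sub_le (t + 1 / ((n : ℝ) + 1)) t
    rw [add_sub_cancel_left, Real.norm_of_nonneg (by positivity)] at h
    simp only [D]
    rw [norm_smul, Real.norm_of_nonneg hn.le]
    calc _ ≤ ((n : ℝ) + 1) * (L * (1 / ((n : ℝ) + 1))) := by gcongr
      _ = L := by field_simp
  have hmem : ∀ n, MemLp (D n) 2 μ := fun n =>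
    MemLp.of_bound (hDc n).aestronglyMeasurable L (ae_of_all _ (hDb n))
  let A : ℕ → Lp E 2 μ := fun n => (hmem n).toLp
  obtain ⟨C, hC⟩ : ∃ C, ∀ n, ‖A n‖ ≤ C := by
    refine ⟨_, fun n => Lp.norm_le_of_ae_bound (C := L) L.2 ?_⟩
    filter_upwards [(hmem n).coeFn_toLp] with t ht
    rw [ht]; exact hDb n t
  let W : ℕ → WeakDual ℝ (Lp E 2 μ) := fun n =>
    StrongDual.toWeakDual (InnerProductSpace.toDual ℝ (Lp E 2 μ) (A n))
  have hcomp := WeakDual.isCompact_closedBall (𝕜 := ℝ) (0 : StrongDual ℝ (Lp E 2 μ)) C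
  -- A limit along an ultrafilter replaces a weakly convergent subsequence, so separability plays no
  -- role.
  obtain ⟨w, -, hw⟩ := hcomp.ultrafilter_le_nhds ((Filter.hyperfilter ℕ).map W) (by
    refine Filter.le_principal_iff.2 (Filter.mem_map.2 (Filter.univ_mem' fun n => ?_))
    simpa [W] using hC n)
  let g : Lp E 2 μ := (InnerProductSpace.toDual ℝ (Lp E 2 μ)).symm (WeakDual.toStrongDual w)
  have hlim : ∀ y : Lp E 2 μ, Filter.Tendsto (fun n => inner ℝ (A n) y)
      (Filter.hyperfilter ℕ : Filter ℕ) (nhds (inner ℝ g y)) := fun y => by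
    have h1 : Filter.Tendsto (fun n => W n y) (Filter.hyperfilter ℕ : Filter ℕ) (nhds (w y)) :=
      ((WeakDual.eval_continuous y).tendsto w).comp hw
    have h2 : inner ℝ g y = w y := by
      simp [g, InnerProductSpace.toDual_symm_apply]
    rw [h2]
    exact h1
  have hgi : IntervalIntegrable g volume a b := by
    rw [intervalIntegrable_iff_integrableOn_Ioc_of_le hab]
    exact (Lp.memLp g).integrable (by norm_num)
  have hint : ∀ t ∈ Icc a b, v t = v a + ∫ s in a..t, g s := by
    intro t ht
    have hset : ∀ k : ℝ → E, ∫ s in Ioc a t, k s ∂μ = ∫ s in a..t, k s := fun k => by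
      rw [intervalIntegral.integral_of_le ht.1, Measure.restrict_restrict measurableSet_Ioc,
        Ioc_inter_Ioc, max_self, min_eq_left ht.2]
    have hμ : μ (Ioc a t) ≠ ⊤ := measure_ne_top _ _
    -- After a shift of variable, this integral is a difference of two slopes of the primitive of v,
    -- at t and at a.
    have hDint : Filter.Tendsto (fun n => ∫ s in a..t, D n s) Filter.atTop
        (nhds (v t - v a)) := by
      have hvi : ∀ x y, IntervalIntegrable v volume x y := fun x y => hvc.intervalIntegrable x y
      have hF : ∀ x, HasDerivAt (fun s => ∫ r in a..s, v r) (v x) x := fun x =>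
        intervalIntegral.integral_hasDerivAt_right (hvi a x)
          (hvc.stronglyMeasurableAtFilter _ _) hvc.continuousAt
      have hη : Filter.Tendsto (fun n : ℕ => 1 / ((n : ℝ) + 1)) Filter.atTop
          (nhdsWithin 0 {0}ᶜ) :=
        tendsto_nhdsWithin_iff.2 ⟨tendsto_one_div_add_atTop_nhds_zero_nat,
          Filter.Eventually.of_forall fun n => by
            have : (0 : ℝ) < 1 / ((n : ℝ) + 1) := by positivity
            exact this.ne'⟩
      refine (((hF t).tendsto_slope_zero.comp hη).sub ((hF a).tendsto_slope_zero.comp hη)).congr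
        fun n => ?_
      simp only [D, Function.comp, one_div, inv_inv]
      have hsh : IntervalIntegrable (fun s => v (s + ((n : ℝ) + 1)⁻¹)) volume a t :=
        Continuous.intervalIntegrable (by fun_prop) _ _
      rw [intervalIntegral.integral_smul, ← smul_sub, intervalIntegral.integral_sub hsh (hvi _ _),
        intervalIntegral.integral_comp_add_right, intervalIntegral.integral_same, sub_zero,
        ← intervalIntegral.integral_interval_sub_left (hvi a (t + _)) (hvi a (a + _))]
      congr 1
      abel
    suffices ∫ s in a..t, g s = v t - v a by rw [this]; abel
    refine ext_inner_left ℝ fun e => ?_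
    have h1 := hlim (indicatorConstLp 2 measurableSet_Ioc hμ e)
    have h2 : ∀ k : Lp E 2 μ, inner ℝ k (indicatorConstLp 2 measurableSet_Ioc hμ e) =
        inner ℝ e (∫ s in a..t, k s) := fun k => by
      rw [real_inner_comm, L2.inner_indicatorConstLp_eq_inner_setIntegral, hset]
    simp only [h2] at h1
    have h3 : ∀ n, ∫ s in a..t, A n s = ∫ s in a..t, D n s := fun n => by
      rw [← hset, ← hset]
      exact integral_congr_ae (ae_restrict_of_ae (hmem n).coeFn_toLp)
    simp only [h3] at h1
    refine tendsto_nhds_unique h1 ?_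
    exact (tendsto_const_nhds.inner hDint).mono_left Nat.hyperfilter_le_atTop
  filter_upwards [hgi.ae_hasDerivAt_integral] with t ht htI
  rw [uIcc_of_le hab] at ht
  have h1 := (ht (Ioo_subset_Icc_self htI) a (left_mem_Icc.2 hab)).const_add (v a)
  refine (h1.congr_of_eventuallyEq ?_).differentiableAt
  filter_upwards [Ioo_mem_nhds htI.1 htI.2] with s hs
  exact hint s (Ioo_subset_Icc_self hs)

/-- Lipschitz curves in a Hilbert space are a.e. differentiable. -/
theorem LipschitzWith.ae_differentiableAt_of_hilbert {v : ℝ → E} {L : NNReal}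
    (hv : LipschitzWith L v) : ∀ᵐ t, DifferentiableAt ℝ v t := by
  have h := ae_all_iff.2 fun n : ℕ =>
    hv.ae_differentiableAt_of_hilbert_Ioo (a := -(n : ℝ)) (b := n) (by simp)
  filter_upwards [h] with t ht
  obtain ⟨n, hn⟩ := exists_nat_gt |t|
  exact ht n (abs_lt.1 hn)

end

/-! ### Euler polygons and their limit for bounded fields. -/

section
variable {E : Type*} [NormedAddCommGroup E] [InnerProductSpace ℝ E]

/-- Stability: two curves whose relative motion is dissipative up to a Lipschitz term and an error
`δ` stay close. -/
theorem norm_sub_sq_le_of_inner_deriv_sub_le {z₁ z₂ : ℝ → E} {T K δ : ℝ} {L₁ L₂ : NNReal}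
    (hT : 0 ≤ T) (hK : 0 < K) (hδ : 0 ≤ δ)
    (h₁ : LipschitzOnWith L₁ z₁ (Icc 0 T)) (h₂ : LipschitzOnWith L₂ z₂ (Icc 0 T))
    (h0 : z₁ 0 = z₂ 0)
    (h : ∀ᵐ t, t ∈ Ioo 0 T → DifferentiableAt ℝ z₁ t ∧ DifferentiableAt ℝ z₂ t ∧
      inner ℝ (deriv z₁ t - deriv z₂ t) (z₁ t - z₂ t) ≤ K * ‖z₁ t - z₂ t‖ ^ 2 + δ) :
    ‖z₁ T - z₂ T‖ ^ 2 ≤ Real.exp (2 * K * T) * (δ / K) := by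
  have hL : LipschitzOnWith (L₁ + L₂) (fun t => z₁ t - z₂ t) (uIcc 0 T) := by
    rw [uIcc_of_le hT]; exact h₁.sub h₂
  have hg := hL.absolutelyContinuousOnInterval_norm_sq.gronwall hT (C := 2 * K) (δ := 2 * δ)
    (by positivity) (by positivity) (by
      filter_upwards [h] with t ht htI
      obtain ⟨hd₁, hd₂, hle⟩ := ht htI
      have hd := (hd₁.hasDerivAt.sub hd₂.hasDerivAt).norm_sq
      have hdd : deriv (fun t => ‖z₁ t - z₂ t‖ ^ 2) t = _ := hd.deriv
      rw [hdd, real_inner_comm]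
      simp only [Pi.sub_apply]
      linarith)
  rw [h0, sub_self, norm_zero, mul_div_mul_left _ _ two_ne_zero] at hg
  simpa using hg

/-- The polygons of the explicit Euler scheme for `z' = F(z)` with a bounded, possibly
discontinuous field `F`. -/
theorem exists_euler_polygon [CompleteSpace E] {F : E → E} {M : NNReal} (hF : ∀ u, ‖F u‖ ≤ M)
    (z₀ : E) {h : ℝ} (hh : 0 < h) :
    ∃ z ζ : ℝ → E, z 0 = z₀ ∧ LipschitzWith M z ∧ (∀ᵐ t, HasDerivAt z (F (ζ t)) t) ∧
      ∀ t, 0 ≤ t → ‖z t - ζ t‖ ≤ M * h := by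
  let Z : ℕ → E := fun n => (fun u => u + h • F u)^[n] z₀
  let ζ : ℝ → E := fun t => Z ⌊t / h⌋₊
  -- F itself need not be measurable: the composite factors through the discrete index ⌊t / h⌋.
  have hmeas : StronglyMeasurable fun t => F (ζ t) := by
    have h1 : StronglyMeasurable fun n : ℕ => F (Z n) := StronglyMeasurable.of_discrete
    exact h1.comp_measurable (Nat.measurable_floor.comp (measurable_id.div_const h))
  have hloc : LocallyIntegrable fun t => F (ζ t) :=
    (locallyIntegrable_const (M : ℝ)).mono hmeas.aestronglyMeasurable
      (ae_of_all _ fun t => by simpa using hF (ζ t))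
  have hint : ∀ a b, IntervalIntegrable (fun t => F (ζ t)) volume a b := fun a b =>
    intervalIntegrable_iff.2 ((hloc.integrableOn_isCompact isCompact_uIcc).mono_set
      uIoc_subset_uIcc)
  let z : ℝ → E := fun t => z₀ + ∫ s in (0 : ℝ)..t, F (ζ s)
  have hsub : ∀ a b, z b - z a = ∫ s in a..b, F (ζ s) := fun a b => by
    simp only [z]
    rw [add_sub_add_left_eq_sub, intervalIntegral.integral_interval_sub_left (hint _ _) (hint _ _)]
  have hlip : LipschitzWith M z := LipschitzWith.of_dist_le_mul fun a b => by
    rw [dist_eq_norm, hsub, Real.dist_eq]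
    exact intervalIntegral.norm_integral_le_of_norm_le_const fun t _ => hF _
  have hZ : ∀ n : ℕ, z (n * h) = Z n := by
    intro n
    induction n with
    | zero => simp [z, Z]
    | succ n ih =>
      have h1 : z ((n + 1 : ℕ) * h) = z (n * h) + ∫ s in (n * h)..((n + 1 : ℕ) * h), F (ζ s) := by
        rw [← hsub]; abel
      have h2 : ∫ s in (n * h)..((n + 1 : ℕ) * h), F (ζ s) =
          ∫ s in (n * h)..((n + 1 : ℕ) * h), F (Z n) := by
        refine intervalIntegral.integral_congr_ae ?_
        -- At the right endpoint the floor already jumps to n + 1.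
        have hne : ∀ᵐ s : ℝ, s ≠ (n + 1 : ℕ) * h := by simp [ae_iff, measure_singleton]
        filter_upwards [hne] with s hs hsI
        have hle : (n : ℝ) * h ≤ (n + 1 : ℕ) * h := by push_cast; nlinarith
        rw [uIoc_of_le hle] at hsI
        have hfl : ⌊s / h⌋₊ = n := by
          rw [Nat.floor_eq_iff (div_nonneg (le_trans (by positivity) hsI.1.le) hh.le),
            le_div_iff₀ hh, div_lt_iff₀ hh]
          refine ⟨hsI.1.le, ?_⟩
          have := lt_of_le_of_ne hsI.2 hs
          push_cast at this
          exact this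
        simp only [ζ, hfl]
      rw [h1, ih, h2, intervalIntegral.integral_const]
      simp only [Z, Function.iterate_succ_apply']
      congr 2
      push_cast; ring
  refine ⟨z, ζ, by simp [z], hlip, ?_, fun t ht => ?_⟩
  · filter_upwards [LocallyIntegrable.ae_hasDerivAt_integral hloc] with t ht
    exact (ht 0).const_add z₀
  · have h1 := hlip.norm_sub_le t (⌊t / h⌋₊ * h)
    rw [hZ] at h1
    refine h1.trans (mul_le_mul_of_nonneg_left ?_ M.2)
    have h2 := Nat.floor_le (div_nonneg ht hh.le)
    have h3 := Nat.lt_floor_add_one (t / h)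
    rw [le_div_iff₀ hh] at h2
    rw [div_lt_iff₀ hh] at h3
    rw [Real.norm_of_nonneg (by linarith)]
    linarith

theorem subdifferential_monotone {Ψ : E → ℝ} {u v p q : E} (hp : p ∈ subdifferential Ψ u)
    (hq : q ∈ subdifferential Ψ v) : 0 ≤ inner ℝ (p - q) (u - v) := by
  have h1 := hp v
  have h2 := hq u
  rw [← neg_sub u v, inner_neg_right] at h1
  rw [inner_sub_left]
  linarith

/-- Subtracting a monotone part from B can only decrease the pairing with u - v. This one-sided
Lipschitz bound feeds every Gronwall estimate below. -/
theorem inner_sub_sub_le_of_mem_subdifferential {Ψ : E → ℝ} {B : E → E} {K : ℝ} {u v p q : E}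
    (hB : ‖B u - B v‖ ≤ K * ‖u - v‖) (hp : B u - p ∈ subdifferential Ψ u)
    (hq : B v - q ∈ subdifferential Ψ v) : inner ℝ (p - q) (u - v) ≤ K * ‖u - v‖ ^ 2 := by
  have h1 := subdifferential_monotone hp hq
  have h2 : B u - p - (B v - q) = (B u - B v) - (p - q) := by abel
  rw [h2, inner_sub_left] at h1
  have h3 := real_inner_le_norm (B u - B v) (u - v)
  nlinarith [mul_le_mul_of_nonneg_right hB (norm_nonneg (u - v))]

/-- Passage to the limit in the differential inclusion along equi-Lipschitz approximations. -/
theorem mem_subdifferential_of_tendsto_approx {Ψ : E → ℝ} (hΨ : Continuous Ψ) {B F : E → E}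
    (hB : Continuous B) {M : NNReal} (hF : ∀ u, ‖F u‖ ≤ M)
    (hFm : ∀ u, B u - F u ∈ subdifferential Ψ u) {z ζ : ℕ → ℝ → E} {h : ℕ → ℝ}
    (hh : Filter.Tendsto h Filter.atTop (nhds 0)) (hL : ∀ n, LipschitzWith M (z n))
    (hd : ∀ n, ∀ᵐ t, HasDerivAt (z n) (F (ζ n t)) t)
    (hζ : ∀ n t, 0 ≤ t → ‖z n t - ζ n t‖ ≤ M * h n) {y : ℝ → E}
    (hy : ∀ t, 0 ≤ t → Filter.Tendsto (fun n => z n t) Filter.atTop (nhds (y t)))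
    {t₀ : ℝ} (ht₀ : 0 < t₀) (hyd : DifferentiableAt ℝ y t₀) :
    B (y t₀) - deriv y t₀ ∈ subdifferential Ψ (y t₀) := by
  intro w
  -- Joint convergence in (n, t), from pointwise convergence at t₀ and the common Lipschitz
  -- constant.
  have hlim : Filter.Tendsto (fun p : ℕ × ℝ => ζ p.1 p.2) (Filter.atTop ×ˢ nhds t₀)
      (nhds (y t₀)) := by
    rw [tendsto_iff_norm_sub_tendsto_zero]
    have hfst : Filter.Tendsto (fun p : ℕ × ℝ => p.1) (Filter.atTop ×ˢ nhds t₀) Filter.atTop :=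
      Filter.tendsto_fst
    have hsnd : Filter.Tendsto (fun p : ℕ × ℝ => p.2) (Filter.atTop ×ˢ nhds t₀) (nhds t₀) :=
      Filter.tendsto_snd
    have h1 : Filter.Tendsto (fun p : ℕ × ℝ => M * h p.1 + M * ‖p.2 - t₀‖ + ‖z p.1 t₀ - y t₀‖)
        (Filter.atTop ×ˢ nhds t₀) (nhds 0) := by
      have h2 := (tendsto_iff_norm_sub_tendsto_zero.1 (hy t₀ ht₀.le)).comp hfst
      have h3 := (tendsto_iff_norm_sub_tendsto_zero.1 hsnd).const_mul (M : ℝ)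
      have h4 := (hh.comp hfst).const_mul (M : ℝ)
      simpa using (h4.add h3).add h2
    refine squeeze_zero' (Filter.Eventually.of_forall fun _ => norm_nonneg _) ?_ h1
    filter_upwards [hsnd (lt_mem_nhds ht₀)] with p hp
    have e1 := hζ p.1 p.2 (le_of_lt hp)
    have e2 := (hL p.1).norm_sub_le p.2 t₀
    have e3 : ζ p.1 p.2 - y t₀ =
      (z p.1 t₀ - y t₀) + (z p.1 p.2 - z p.1 t₀) - (z p.1 p.2 - ζ p.1 p.2) := by abel
    rw [e3]
    refine (norm_sub_le _ _).trans ?_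
    linarith [norm_add_le (z p.1 t₀ - y t₀) (z p.1 p.2 - z p.1 t₀)]
  -- A.e. the left side is half the derivative of ‖z n - w‖²; moving from ζ to z costs M · M h.
  have hbound : ∀ n t, 0 ≤ t → inner ℝ (F (ζ n t)) (z n t - w) ≤
      M * (M * h n) + inner ℝ (B (ζ n t)) (ζ n t - w) + Ψ w - Ψ (ζ n t) := by
    intro n t ht
    have e1 := hFm (ζ n t) w
    have e2 : inner ℝ (F (ζ n t)) (z n t - w) = inner ℝ (F (ζ n t)) (z n t - ζ n t) +
        inner ℝ (F (ζ n t)) (ζ n t - w) := by rw [← inner_add_right]; congr 1; abel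
    have e3 : inner ℝ (F (ζ n t)) (z n t - ζ n t) ≤ M * (M * h n) :=
      (real_inner_le_norm _ _).trans (mul_le_mul (hF _) (hζ n t ht) (norm_nonneg _) M.2)
    rw [← neg_sub (ζ n t) w, inner_neg_right, inner_sub_left] at e1
    linarith
  have hc : Filter.Tendsto (fun p : ℕ × ℝ => M * (M * h p.1) +
      inner ℝ (B (ζ p.1 p.2)) (ζ p.1 p.2 - w) + Ψ w - Ψ (ζ p.1 p.2)) (Filter.atTop ×ˢ nhds t₀)
      (nhds (inner ℝ (B (y t₀)) (y t₀ - w) + Ψ w - Ψ (y t₀))) := by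
    have hfst : Filter.Tendsto (fun p : ℕ × ℝ => p.1) (Filter.atTop ×ˢ nhds t₀) Filter.atTop :=
      Filter.tendsto_fst
    have h4 := ((hh.comp hfst).const_mul (M : ℝ)).const_mul (M : ℝ)
    have h5 : Filter.Tendsto (fun p : ℕ × ℝ => inner ℝ (B (ζ p.1 p.2)) (ζ p.1 p.2 - w))
        (Filter.atTop ×ˢ nhds t₀) (nhds (inner ℝ (B (y t₀)) (y t₀ - w))) :=
      ((hB.tendsto _).comp hlim).inner (hlim.sub_const w)
    have h6 := ((h4.add h5).add_const (Ψ w)).sub ((hΨ.tendsto _).comp hlim)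
    simpa using h6
  set c := inner ℝ (B (y t₀)) (y t₀ - w) + Ψ w - Ψ (y t₀) with hcdef
  have key : inner ℝ (deriv y t₀) (y t₀ - w) ≤ c := by
    refine le_of_forall_pos_le_add fun ε hε => ?_
    have hev := (hc.eventually_lt_const (lt_add_of_pos_right c hε))
    obtain ⟨P, hP, Q, hQ, hPQ⟩ := Filter.eventually_prod_iff.1 hev
    obtain ⟨r, hr, hrQ⟩ := Metric.eventually_nhds_iff.1 hQ
    -- The inequality is integrated over [t₀, t] before n → ∞; the right slope at t₀ then recovers
    -- the derivative of y.
    have hinc : ∀ t ∈ Ioo t₀ (t₀ + r), ‖y t - w‖ ^ 2 - ‖y t₀ - w‖ ^ 2 ≤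
        2 * (c + ε) * (t - t₀) := by
      intro t ht
      have hlimt : ∀ s, 0 ≤ s → Filter.Tendsto (fun n => ‖z n s - w‖ ^ 2) Filter.atTop
          (nhds (‖y s - w‖ ^ 2)) := fun s hs => (((hy s hs).sub_const w).norm).pow 2
      refine le_of_tendsto ((hlimt t (ht₀.trans ht.1).le).sub (hlimt t₀ ht₀.le)) ?_
      filter_upwards [hP] with n hn
      have hLip : LipschitzOnWith (M + 0) (fun s => z n s - w) (uIcc t₀ t) :=
        ((hL n).lipschitzOnWith).sub ((LipschitzWith.const w).lipschitzOnWith)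
      refine hLip.absolutelyContinuousOnInterval_norm_sq.sub_le_of_ae_deriv_le ht.1.le ?_
      filter_upwards [hd n] with s hs hsI
      have hds := ((hs.sub_const w).norm_sq)
      rw [hds.deriv, real_inner_comm]
      have h7 := hPQ hn (hrQ (y := s) (by
        rw [Real.dist_eq, abs_of_pos (by linarith [hsI.1])]; linarith [hsI.2, ht.2]))
      have h8 := hbound n s (by linarith [hsI.1])
      simp only at h7
      linarith
    have hdy := (hyd.hasDerivAt.sub_const w).norm_sq
    have hsl := (hasDerivAt_iff_tendsto_slope.1 hdy).mono_left
      (nhdsWithin_mono t₀ (fun x (hx : x ∈ Ioi t₀) => ne_of_gt hx))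
    have hle := le_of_tendsto hsl (b := 2 * (c + ε)) (by
      filter_upwards [Ioo_mem_nhdsGT (show t₀ < t₀ + r by linarith)] with t ht
      rw [slope_def_field, div_le_iff₀ (by linarith [ht.1])]
      exact hinc t ht)
    rw [real_inner_comm] at hle
    linarith
  rw [← neg_sub (y t₀) w, inner_neg_right, inner_sub_left]
  linarith

/-- Strong solvability of `z' + ∂Ψ(z) ∋ B(z)` for bounded Lipschitz `B` and bounded `∂Ψ`. -/
theorem exists_solution_of_bounded [CompleteSpace E] {Ψ : E → ℝ} (hΨ : Continuous Ψ) {B F : E → E}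
    {K M : NNReal} (hB : LipschitzWith K B) (hF : ∀ u, ‖F u‖ ≤ M)
    (hFm : ∀ u, B u - F u ∈ subdifferential Ψ u) (z₀ : E) :
    ∃ y : ℝ → E, y 0 = z₀ ∧ LipschitzWith M y ∧
      ∀ᵐ t, 0 < t → DifferentiableAt ℝ y t ∧ B (y t) - deriv y t ∈ subdifferential Ψ (y t) := by
  let h : ℕ → ℝ := fun n => 1 / ((n : ℝ) + 1)
  have hpos : ∀ n, 0 < h n := fun n => by positivity
  have hanti : ∀ {m n}, m ≤ n → h n ≤ h m := fun hmn => one_div_le_one_div_of_le (by positivity)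
    (by have : (_ : ℝ) ≤ _ := Nat.cast_le.2 hmn; linarith)
  have hle1 : ∀ n, h n ≤ 1 := fun n => (hanti n.zero_le).trans (by simp [h])
  have hh : Filter.Tendsto h Filter.atTop (nhds 0) := tendsto_one_div_add_atTop_nhds_zero_nat
  choose z ζ hz0 hL hd hζ using fun n => exists_euler_polygon hF z₀ (hpos n)
  -- With s = h n + h m, replacing ζ by z costs 2M²s in the pairing and turns K‖ζ n - ζ m‖² into at
  -- most 2K‖z n - z m‖² + 4KM²s, using s ≤ 2. The extra 1 keeps the rate positive.
  let c : ℝ → ℝ := fun t =>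
    Real.exp (2 * (2 * K + 1) * t) * ((2 * M ^ 2 + 4 * K * M ^ 2) / (2 * K + 1))
  have hc : ∀ t, 0 ≤ c t := fun t => by positivity
  have hdist : ∀ n m t, 0 ≤ t → ‖z n t - z m t‖ ^ 2 ≤ c t * (h n + h m) := by
    intro n m t ht
    have h1 := norm_sub_sq_le_of_inner_deriv_sub_le (K := 2 * K + 1)
      (δ := (2 * M ^ 2 + 4 * K * M ^ 2) * (h n + h m)) ht (by positivity)
      (mul_nonneg (by positivity) (add_nonneg (hpos n).le (hpos m).le))
      (hL n).lipschitzOnWith (hL m).lipschitzOnWith ((hz0 n).trans (hz0 m).symm) (by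
        filter_upwards [hd n, hd m] with s hn hm hs
        refine ⟨hn.differentiableAt, hm.differentiableAt, ?_⟩
        rw [hn.deriv, hm.deriv]
        have e1 := inner_sub_sub_le_of_mem_subdifferential (hB.norm_sub_le _ _)
          (hFm (ζ n s)) (hFm (ζ m s))
        have e2 := hζ n s hs.1.le
        have e3 := hζ m s hs.1.le
        have hM : (0 : ℝ) ≤ M := M.2
        have hK : (0 : ℝ) ≤ K := K.2
        have hs0 : 0 ≤ h n + h m := add_nonneg (hpos n).le (hpos m).le
        have e4 : ‖(z n s - ζ n s) - (z m s - ζ m s)‖ ≤ M * (h n + h m) :=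
          (norm_sub_le _ _).trans (by linarith)
        have e5 : inner ℝ (F (ζ n s) - F (ζ m s)) ((z n s - ζ n s) - (z m s - ζ m s)) ≤
            (2 * M) * (M * (h n + h m)) := (real_inner_le_norm _ _).trans <|
          mul_le_mul ((norm_sub_le _ _).trans (by linarith [hF (ζ n s), hF (ζ m s)])) e4
            (norm_nonneg _) (by positivity)
        have e6 : z n s - z m s = ((z n s - ζ n s) - (z m s - ζ m s)) + (ζ n s - ζ m s) := by abel
        have e7 : ‖ζ n s - ζ m s‖ ≤ ‖z n s - z m s‖ + M * (h n + h m) := by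
          have : ζ n s - ζ m s = (z n s - z m s) - ((z n s - ζ n s) - (z m s - ζ m s)) := by abel
          rw [this]
          exact (norm_sub_le _ _).trans (by linarith)
        have e8 : ‖ζ n s - ζ m s‖ ^ 2 ≤ 2 * ‖z n s - z m s‖ ^ 2 + 4 * M ^ 2 * (h n + h m) := by
          have a1 : ‖ζ n s - ζ m s‖ ^ 2 ≤ (‖z n s - z m s‖ + M * (h n + h m)) ^ 2 := by
            gcongr
          have a2 := add_sq_le (a := ‖z n s - z m s‖) (b := M * (h n + h m))
          have a3 : (M * (h n + h m)) ^ 2 ≤ M ^ 2 * (2 * (h n + h m)) := by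
            rw [mul_pow]
            refine mul_le_mul_of_nonneg_left ?_ (by positivity)
            nlinarith [hle1 n, hle1 m]
          linarith
        have e9 : inner ℝ (F (ζ n s) - F (ζ m s)) (z n s - z m s) =
            inner ℝ (F (ζ n s) - F (ζ m s)) ((z n s - ζ n s) - (z m s - ζ m s)) +
            inner ℝ (F (ζ n s) - F (ζ m s)) (ζ n s - ζ m s) := by
          rw [← inner_add_right, ← e6]
        rw [e9]
        have e10 := mul_le_mul_of_nonneg_left e8 hK
        nlinarith [sq_nonneg ‖z n s - z m s‖])
    refine h1.trans (le_of_eq ?_)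
    simp only [c]; ring
  have hcauchy : ∀ t, 0 ≤ t → CauchySeq fun n => z n t := by
    intro t ht
    refine cauchySeq_of_le_tendsto_0 (fun N => Real.sqrt (c t * (2 * h N))) (fun n m N hn hm => ?_) ?_
    · rw [dist_eq_norm]
      refine Real.le_sqrt_of_sq_le ((hdist n m t ht).trans ?_)
      exact mul_le_mul_of_nonneg_left (by linarith [hanti hn, hanti hm]) (hc t)
    · simpa using ((hh.const_mul 2).const_mul (c t)).sqrt
  -- Clamping at 0 makes the limit a Lipschitz curve on all of ℝ.
  have hex : ∀ t, ∃ l, Filter.Tendsto (fun n => z n (max t 0)) Filter.atTop (nhds l) := fun t =>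
    cauchySeq_tendsto_of_complete (hcauchy _ (le_max_right _ _))
  choose y hy using hex
  have hy' : ∀ t, 0 ≤ t → Filter.Tendsto (fun n => z n t) Filter.atTop (nhds (y t)) :=
    fun t ht => by simpa [max_eq_left ht] using hy t
  have hyL : LipschitzWith M y := LipschitzWith.of_dist_le_mul fun a b => by
    refine le_of_tendsto ((hy a).dist (hy b)) (Filter.Eventually.of_forall fun n => ?_)
    simpa using ((hL n).comp (LipschitzWith.id.max_const 0)).dist_le_mul a b
  refine ⟨y, ?_, hyL, ?_⟩
  · refine tendsto_nhds_unique (hy' 0 le_rfl) ?_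
    simp [hz0]
  · filter_upwards [hyL.ae_differentiableAt_of_hilbert] with t ht htpos
    exact ⟨ht, mem_subdifferential_of_tendsto_approx hΨ hB.continuous hF hFm hh hL hd hζ hy'
      htpos ht⟩

end

/-! ### Truncation, uniqueness and global continuation. -/

section
variable {E : Type*} [NormedAddCommGroup E]

/-- The radial retraction onto the closed ball of radius `R` around the origin. -/
noncomputable def radialRetraction [NormedSpace ℝ E] (R : ℝ) (u : E) : E := (R / max R ‖u‖) • u

theorem radialRetraction_of_norm_le [NormedSpace ℝ E] {R : ℝ} (hR : 0 < R) {u : E}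
    (hu : ‖u‖ ≤ R) : radialRetraction R u = u := by
  rw [radialRetraction, max_eq_left hu, div_self hR.ne', one_smul]

theorem norm_radialRetraction_le [NormedSpace ℝ E] {R : ℝ} (hR : 0 < R) (u : E) :
    ‖radialRetraction R u‖ ≤ R := by
  have hm : 0 < max R ‖u‖ := lt_max_of_lt_left hR
  rw [radialRetraction, norm_smul, Real.norm_of_nonneg (by positivity), div_mul_eq_mul_div,
    div_le_iff₀ hm]
  exact mul_le_mul_of_nonneg_left (le_max_right _ _) hR.le

/-- The change of the vector and the change of the scaling factor each contribute at most ‖u - v‖.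
-/
theorem lipschitzWith_radialRetraction [NormedSpace ℝ E] {R : ℝ} (hR : 0 < R) :
    LipschitzWith 2 (radialRetraction R : E → E) := LipschitzWith.of_dist_le_mul fun u v => by
  have hu : 0 < max R ‖u‖ := lt_max_of_lt_left hR
  have hv : 0 < max R ‖v‖ := lt_max_of_lt_left hR
  have h1 : radialRetraction R u - radialRetraction R v =
      (R / max R ‖u‖) • (u - v) + (R / max R ‖u‖ - R / max R ‖v‖) • v := by
    simp only [radialRetraction, smul_sub, sub_smul]; abel
  have h2 : ‖(R / max R ‖u‖) • (u - v)‖ ≤ ‖u - v‖ := by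
    rw [norm_smul, Real.norm_of_nonneg (by positivity)]
    exact mul_le_of_le_one_left (norm_nonneg _) ((div_le_one hu).2 (le_max_left _ _))
  have h3 : ‖(R / max R ‖u‖ - R / max R ‖v‖) • v‖ ≤ ‖u - v‖ := by
    have e1 : R / max R ‖u‖ - R / max R ‖v‖ =
        (R / max R ‖u‖) * ((max R ‖v‖ - max R ‖u‖) / max R ‖v‖) := by field_simp
    have e2 : |max R ‖v‖ - max R ‖u‖| ≤ ‖u - v‖ := by
      rw [← norm_sub_rev, max_comm R, max_comm R]
      exact (abs_max_sub_max_le_abs _ _ _).trans (abs_norm_sub_norm_le _ _)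
    rw [e1, norm_smul, Real.norm_eq_abs, abs_mul, abs_of_nonneg (a := R / max R ‖u‖) (by positivity),
      abs_div, abs_of_pos hv, mul_assoc]
    refine (mul_le_of_le_one_left (by positivity) ((div_le_one hu).2 (le_max_left _ _))).trans ?_
    rw [div_mul_eq_mul_div, div_le_iff₀ hv]
    exact mul_le_mul e2 (le_max_right _ _) (norm_nonneg _) (norm_nonneg _)
  rw [dist_eq_norm, dist_eq_norm, h1]
  refine (norm_add_le _ _).trans ?_
  push_cast
  linarith

variable [InnerProductSpace ℝ E]

theorem norm_le_of_mem_subdifferential_of_lipschitz {ψ : E → ℝ} {M : NNReal}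
    (hψ : LipschitzWith M ψ) {u p : E} (hp : p ∈ subdifferential ψ u) : ‖p‖ ≤ M := by
  have h1 := hp (u + p)
  have h2 := hψ.norm_sub_le (u + p) u
  rw [add_sub_cancel_left] at h1 h2
  rw [real_inner_self_eq_norm_sq] at h1
  have h3 := (le_abs_self _).trans h2
  rcases (norm_nonneg p).eq_or_lt with h0 | h0
  · rw [← h0]; exact M.2
  · nlinarith

/-- A convex function with a section of the subdifferential that is bounded on a ball agrees on
this ball with a globally Lipschitz convex minorant. -/
theorem exists_lipschitz_convex_minorant {Ψ : E → ℝ} {q : E → E} {R : ℝ} {M : NNReal} (hR : 0 ≤ R)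
    (hq : ∀ u, q u ∈ subdifferential Ψ u) (hM : ∀ u, ‖u‖ ≤ R → ‖q u‖ ≤ M) :
    ∃ ψ : E → ℝ, ConvexOn ℝ univ ψ ∧ LipschitzWith M ψ ∧ (∀ u, ψ u ≤ Ψ u) ∧
      ∀ u, ‖u‖ ≤ R → ψ u = Ψ u := by
  -- Affine minorants based in the ball have slope at most M, and the one based at u is exact at u;
  -- their supremum is the required function.
  let l : E → Metric.closedBall (0 : E) R → ℝ := fun u w => Ψ w + inner ℝ (q w) (u - w)
  have : Nonempty (Metric.closedBall (0 : E) R) := ⟨⟨0, by simpa using hR⟩⟩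
  have hle : ∀ u w, l u w ≤ Ψ u := fun u w => hq w u
  have hbdd : ∀ u, BddAbove (range (l u)) := fun u => ⟨Ψ u, by rintro _ ⟨w, rfl⟩; exact hle u w⟩
  refine ⟨fun u => ⨆ w, l u w, ⟨convex_univ, fun u _ v _ a b ha hb hab => ?_⟩, ?_,
    fun u => ciSup_le (hle u), fun u hu => ?_⟩
  · refine ciSup_le fun w => ?_
    have h1 := mul_le_mul_of_nonneg_left (le_ciSup (hbdd u) w) ha
    have h2 := mul_le_mul_of_nonneg_left (le_ciSup (hbdd v) w) hb
    have h3 : l (a • u + b • v) w = a * l u w + b * l v w := by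
      have e : a • u + b • v - (w : E) = a • (u - (w : E)) + b • (v - (w : E)) := by
        have : (w : E) = a • (w : E) + b • (w : E) := by rw [← add_smul, hab, one_smul]
        nth_rw 1 [this]
        simp only [smul_sub]; abel
      simp only [l]
      rw [e, inner_add_right, real_inner_smul_right, real_inner_smul_right]
      linear_combination (-(Ψ w)) * hab
    rw [h3]
    exact add_le_add h1 h2
  · refine LipschitzWith.of_le_add_mul M fun u v => ciSup_le fun w => ?_
    have h1 : l u w = l v w + inner ℝ (q w) (u - v) := by
      simp only [l]
      rw [add_assoc, ← inner_add_right]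
      congr 2; abel
    rw [h1, dist_eq_norm]
    refine add_le_add (le_ciSup (hbdd v) w) ((real_inner_le_norm _ _).trans ?_)
    gcongr
    exact hM w (mem_closedBall_zero_iff.1 w.2)
  · refine le_antisymm (ciSup_le (hle u)) ?_
    have := le_ciSup (hbdd u) ⟨u, by simpa using hu⟩
    simpa [l] using this

/-- Strong solutions on `[0, T]` of the first-order inclusion `z' + ∂Ψ(z) ∋ B(z)`. -/
def IsSolutionOn (Ψ : E → ℝ) (B : E → E) (z : ℝ → E) (T : ℝ) : Prop :=
  (∃ L, LipschitzOnWith L z (Icc 0 T)) ∧ ∀ᵐ t, t ∈ Ioo 0 T →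
    DifferentiableAt ℝ z t ∧ B (z t) - deriv z t ∈ subdifferential Ψ (z t)

namespace IsSolutionOn

variable {Ψ : E → ℝ} {B : E → E} {z y : ℝ → E} {S T : ℝ}

theorem mono (h : IsSolutionOn Ψ B z T) (hST : S ≤ T) : IsSolutionOn Ψ B z S := by
  obtain ⟨⟨L, hL⟩, hae⟩ := h
  refine ⟨⟨L, hL.mono (Icc_subset_Icc_right hST)⟩, ?_⟩
  filter_upwards [hae] with t ht htS
  exact ht (Ioo_subset_Ioo_right hST htS)

theorem congr (h : IsSolutionOn Ψ B z T) (hzy : EqOn y z (Icc 0 T)) : IsSolutionOn Ψ B y T := by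
  obtain ⟨⟨L, hL⟩, hae⟩ := h
  refine ⟨⟨L, fun s hs t ht => ?_⟩, ?_⟩
  · rw [hzy hs, hzy ht]; exact hL hs ht
  · filter_upwards [hae] with t ht htT
    have heq : y =ᶠ[nhds t] z := by
      filter_upwards [Ioo_mem_nhds htT.1 htT.2] with s hs
      exact hzy (Ioo_subset_Icc_self hs)
    rw [heq.deriv_eq, heq.eq_of_nhds]
    exact ⟨(ht htT).1.congr_of_eventuallyEq heq, (ht htT).2⟩

/-- Both curves have compact image on [0, t], so one Lipschitz constant of B serves, and the
stability estimate applies with zero error. -/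
theorem unique (hB : ∀ S : Set E, Bornology.IsBounded S → ∃ K, LipschitzOnWith K B S)
    (hy : IsSolutionOn Ψ B y T) (hz : IsSolutionOn Ψ B z T) (h0 : y 0 = z 0) :
    EqOn y z (Icc 0 T) := by
  intro t ht
  replace hy := hy.mono ht.2
  replace hz := hz.mono ht.2
  obtain ⟨⟨L₁, hL₁⟩, hae₁⟩ := hy
  obtain ⟨⟨L₂, hL₂⟩, hae₂⟩ := hz
  obtain ⟨K, hK⟩ := hB (y '' Icc 0 t ∪ z '' Icc 0 t)
    ((isCompact_Icc.image_of_continuousOn hL₁.continuousOn).isBounded.union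
      (isCompact_Icc.image_of_continuousOn hL₂.continuousOn).isBounded)
  have h := norm_sub_sq_le_of_inner_deriv_sub_le (K := K + 1) (δ := 0) ht.1 (by positivity) le_rfl
    hL₁ hL₂ h0 (by
      filter_upwards [hae₁, hae₂] with s h₁ h₂ hs
      refine ⟨(h₁ hs).1, (h₂ hs).1, ?_⟩
      have hs' := Ioo_subset_Icc_self hs
      have := inner_sub_sub_le_of_mem_subdifferential
        (hK.norm_sub_le (.inl (mem_image_of_mem _ hs')) (.inr (mem_image_of_mem _ hs')))
        (h₁ hs).2 (h₂ hs).2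
      nlinarith [sq_nonneg ‖y s - z s‖])
  rw [zero_div, mul_zero] at h
  have h2 : ‖y t - z t‖ = 0 := by nlinarith [norm_nonneg (y t - z t)]
  exact sub_eq_zero.1 (norm_eq_zero.1 h2)

end IsSolutionOn

variable [CompleteSpace E]

/-- Solvability of `z' + ∂Ψ(z) ∋ B(z)` as long as the solution stays in a ball. -/
theorem exists_solution_in_ball {Ψ : E → ℝ} {B q : E → E}
    (hB : ∀ S : Set E, Bornology.IsBounded S → ∃ K, LipschitzOnWith K B S)
    (hq : ∀ u, q u ∈ subdifferential Ψ u) (hM : ∀ R > 0, ∃ M : ℝ, ∀ u, ‖u‖ ≤ R → ‖q u‖ ≤ M)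
    (z₀ : E) {R : ℝ} (hR : 0 < R) :
    ∃ y : ℝ → E, y 0 = z₀ ∧ (∃ L, LipschitzWith L y) ∧ ∀ᵐ t, 0 < t → DifferentiableAt ℝ y t ∧
      (‖y t‖ ≤ R → B (y t) - deriv y t ∈ subdifferential Ψ (y t)) := by
  obtain ⟨M, hMR⟩ := hM R hR
  obtain ⟨ψ, hψc, hψL, hψle, hψeq⟩ := exists_lipschitz_convex_minorant (M := M.toNNReal) hR.le hq
    fun u hu => (hMR u hu).trans (Real.le_coe_toNNReal M)
  choose p hp using subdifferential_nonempty hψc hψL.continuous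
  obtain ⟨K, hK⟩ := hB (Metric.closedBall 0 R) Metric.isBounded_closedBall
  have hρ : MapsTo (radialRetraction R : E → E) univ (Metric.closedBall 0 R) := fun u _ => by
    simpa using norm_radialRetraction_le hR u
  have hBL : LipschitzWith (K * 2) fun u => B (radialRetraction R u) := by
    rw [← lipschitzOnWith_univ]
    exact hK.comp (lipschitzWith_radialRetraction hR).lipschitzOnWith hρ
  have hBb : ∀ u, ‖B (radialRetraction R u)‖ ≤ ‖B 0‖ + K * R := fun u => by
    have h1 := hK.norm_sub_le (hρ (mem_univ u)) (Metric.mem_closedBall_self hR.le)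
    have h2 := norm_le_insert' (B (radialRetraction R u)) (B 0)
    have h3 := mul_le_mul_of_nonneg_left (norm_radialRetraction_le hR u) K.2
    rw [sub_zero] at h1
    exact h2.trans (by gcongr; exact h1.trans h3)
  let N : NNReal := ⟨‖B 0‖ + K * R, by positivity⟩ + M.toNNReal
  obtain ⟨y, hy0, hyL, hy⟩ := exists_solution_of_bounded hψL.continuous hBL
    (F := fun u => B (radialRetraction R u) - p u) (M := N)
    (fun u => (norm_sub_le _ _).trans (add_le_add (hBb u)
      (norm_le_of_mem_subdifferential_of_lipschitz hψL (hp u))))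
    (fun u => by rw [sub_sub_cancel]; exact hp u) z₀
  refine ⟨y, hy0, ⟨N, hyL⟩, ?_⟩
  filter_upwards [hy] with t ht htpos
  obtain ⟨hd, hsub⟩ := ht htpos
  refine ⟨hd, fun hball w => ?_⟩
  rw [radialRetraction_of_norm_le hR hball] at hsub
  -- A subgradient of a minorant at a point of contact is a subgradient of Ψ.
  rw [← hψeq _ hball]
  exact (hsub w).trans (hψle w)

/-- Global solvability of `z' + ∂Ψ(z) ∋ B(z)` under an a priori bound. -/
theorem exists_global_solution {Ψ : E → ℝ} {B q : E → E}
    (hB : ∀ S : Set E, Bornology.IsBounded S → ∃ K, LipschitzOnWith K B S)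
    (hq : ∀ u, q u ∈ subdifferential Ψ u) (hM : ∀ R > 0, ∃ M : ℝ, ∀ u, ‖u‖ ≤ R → ‖q u‖ ≤ M)
    (z₀ : E) (hbound : ∀ T, 0 ≤ T → ∃ R, ∀ t ∈ Icc 0 T, ∀ z : ℝ → E, IsSolutionOn Ψ B z t →
      z 0 = z₀ → ‖z t‖ ≤ R) :
    ∃ z : ℝ → E, z 0 = z₀ ∧ ∀ T, IsSolutionOn Ψ B z T := by
  have hloc : ∀ T, 0 ≤ T → ∃ z : ℝ → E, z 0 = z₀ ∧ IsSolutionOn Ψ B z T := by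
    intro T hT
    obtain ⟨R, hR⟩ := hbound T hT
    obtain ⟨y, hy0, ⟨L, hL⟩, hy⟩ := exists_solution_in_ball hB hq hM z₀
      (R := |R| + 1) (by positivity)
    have hsol : ∀ t, (∀ s ∈ Ioo 0 t, ‖y s‖ < |R| + 1) → IsSolutionOn Ψ B y t := by
      intro t ht
      refine ⟨⟨L, hL.lipschitzOnWith⟩, ?_⟩
      filter_upwards [hy] with s hs hst
      exact ⟨(hs hst.1).1, (hs hst.1).2 (ht s hst).le⟩
    refine ⟨y, hy0, hsol T fun s hs => ?_⟩
    by_contra! hcon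
    have hne : (Icc 0 T ∩ {t | |R| + 1 ≤ ‖y t‖}).Nonempty := ⟨s, Ioo_subset_Icc_self hs, hcon⟩
    have hcomp : IsCompact (Icc 0 T ∩ {t | |R| + 1 ≤ ‖y t‖}) :=
      isCompact_Icc.inter_right (isClosed_le continuous_const hL.continuous.norm)
    -- Up to the first time τ at which the norm reaches |R| + 1 the truncation is inactive, so the a
    -- priori bound R holds at τ: a contradiction.
    obtain ⟨τ, ⟨hτ, hτR⟩, hmin⟩ := hcomp.exists_isLeast hne
    have h1 := hR τ hτ y (hsol τ fun r hr => by
      by_contra! hr'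
      exact (hmin ⟨⟨hr.1.le, hr.2.le.trans hτ.2⟩, hr'⟩).not_gt hr.2) hy0
    simp only [mem_ofPred_eq] at hτR
    linarith [le_abs_self R]
  -- The horizon n + 1 ensures that `w ⌊t⌋₊` still solves the inclusion in a neighbourhood of each t
  -- > 0.
  choose w hw0 hw using fun n : ℕ => hloc (n + 1) (by positivity)
  have hagree : ∀ (n : ℕ) (t : ℝ), 0 ≤ t → t ≤ n → w ⌊t⌋₊ t = w n t := by
    intro n t ht htn
    have hle : (⌊t⌋₊ : ℝ) + 1 ≤ n + 1 := by
      have : ((⌊t⌋₊ : ℕ) : ℝ) ≤ n := (Nat.floor_le ht).trans htn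
      linarith
    exact IsSolutionOn.unique hB (hw _) ((hw n).mono hle) ((hw0 _).trans (hw0 n).symm)
      ⟨ht, (Nat.lt_floor_add_one t).le⟩
  refine ⟨fun t => w ⌊t⌋₊ t, by simpa using hw0 0, fun T => ?_⟩
  have h1 : T ≤ (⌈T⌉₊ : ℝ) + 1 := (Nat.le_ceil T).trans (by linarith)
  exact ((hw ⌈T⌉₊).mono h1).congr fun t ht => hagree _ t ht.1 (ht.2.trans (Nat.le_ceil T))

end

/-! ### Phase space, energy and the second-order equation. -/

section
variable {H : Type*} [NormedAddCommGroup H]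

theorem norm_le_norm_fst_add_norm_snd (z : WithLp 2 (H × H)) : ‖z‖ ≤ ‖z.fst‖ + ‖z.snd‖ := by
  refine le_of_sq_le_sq ?_ (by positivity)
  rw [WithLp.prod_norm_sq_eq_of_L2]
  nlinarith [norm_nonneg z.fst, norm_nonneg z.snd]

theorem LipschitzOnWith.withLp_fst {z : ℝ → WithLp 2 (H × H)} {L : NNReal} {s : Set ℝ}
    (h : LipschitzOnWith L z s) : LipschitzOnWith L (fun t => (z t).fst) s :=
  LipschitzOnWith.of_dist_le_mul fun a ha b hb =>
    (WithLp.dist_fst_le _ _).trans (h.dist_le_mul a ha b hb)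

theorem LipschitzOnWith.withLp_snd {z : ℝ → WithLp 2 (H × H)} {L : NNReal} {s : Set ℝ}
    (h : LipschitzOnWith L z s) : LipschitzOnWith L (fun t => (z t).snd) s :=
  LipschitzOnWith.of_dist_le_mul fun a ha b hb =>
    (WithLp.dist_snd_le _ _).trans (h.dist_le_mul a ha b hb)

theorem LipschitzOnWith.withLp_prodMk {α : Type*} [PseudoMetricSpace α] {v x : α → H}
    {L₁ L₂ : NNReal} {s : Set α} (hv : LipschitzOnWith L₁ v s) (hx : LipschitzOnWith L₂ x s) :
    LipschitzOnWith (L₁ + L₂) (fun t => WithLp.toLp 2 (v t, x t)) s :=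
  LipschitzOnWith.of_dist_le_mul fun a ha b hb => by
    rw [dist_eq_norm]
    refine (norm_le_norm_fst_add_norm_snd _).trans ?_
    have h1 := hv.dist_le_mul a ha b hb
    have h2 := hx.dist_le_mul a ha b hb
    rw [dist_eq_norm] at h1 h2
    push_cast
    rw [add_mul]
    exact add_le_add h1 h2

variable [InnerProductSpace ℝ H]

theorem HasDerivAt.withLp_fst {z : ℝ → WithLp 2 (H × H)} {z' : WithLp 2 (H × H)} {t : ℝ}
    (h : HasDerivAt z z' t) : HasDerivAt (fun s => (z s).fst) z'.fst t :=
  (WithLp.fstL 2 ℝ H H).hasFDerivAt.comp_hasDerivAt t h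

theorem HasDerivAt.withLp_snd {z : ℝ → WithLp 2 (H × H)} {z' : WithLp 2 (H × H)} {t : ℝ}
    (h : HasDerivAt z z' t) : HasDerivAt (fun s => (z s).snd) z'.snd t :=
  (WithLp.sndL 2 ℝ H H).hasFDerivAt.comp_hasDerivAt t h

theorem HasDerivAt.withLp_prodMk {v x : ℝ → H} {v' x' : H} {t : ℝ} (hv : HasDerivAt v v' t)
    (hx : HasDerivAt x x' t) :
    HasDerivAt (fun s => WithLp.toLp 2 (v s, x s)) (WithLp.toLp 2 (v', x')) t :=
  (WithLp.prodContinuousLinearEquiv 2 ℝ H H).symm.toContinuousLinearMap.hasFDerivAt.comp_hasDerivAt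
    t (hv.prodMk hx)

/-- The damping potential as a function of the phase point `(velocity, position)`. -/
def phasePotential (φ : H → ℝ) (z : WithLp 2 (H × H)) : ℝ := φ z.fst

/-- Moving only the position leaves the potential unchanged, which kills the second component of p.
Hence the inclusion contains the exact equation x' = v. -/
theorem mem_subdifferential_phasePotential {φ : H → ℝ} {z p : WithLp 2 (H × H)} :
    p ∈ subdifferential (phasePotential φ) z ↔ p.fst ∈ subdifferential φ z.fst ∧ p.snd = 0 := by
  constructor
  · intro h
    have h2 : p.snd = 0 := by
      have h3 := h (WithLp.toLp 2 (z.fst, z.snd + p.snd))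
      rw [WithLp.prod_inner_apply] at h3
      simp only [phasePotential, WithLp.ofLp_sub, Prod.fst_sub, Prod.snd_sub,
        WithLp.fst, WithLp.snd, sub_self, inner_zero_right, zero_add, add_sub_cancel_left,
        real_inner_self_eq_norm_sq] at h3
      have h4 : ‖p.ofLp.2‖ = 0 := by nlinarith [norm_nonneg p.ofLp.2]
      exact norm_eq_zero.1 h4
    refine ⟨fun w => ?_, h2⟩
    have h3 := h (WithLp.toLp 2 (w, z.snd))
    rw [WithLp.prod_inner_apply] at h3
    change p.ofLp.2 = 0 at h2
    rw [h2, inner_zero_left, add_zero] at h3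
    exact h3
  · rintro ⟨h1, h2⟩ w
    rw [WithLp.prod_inner_apply]
    change p.ofLp.2 = 0 at h2
    rw [h2, inner_zero_left, add_zero]
    exact h1 w.fst

variable [CompleteSpace H]

/-- The driving field of the first-order system for `(velocity, position)`. -/
noncomputable def phaseField (f : H → ℝ) (z : WithLp 2 (H × H)) : WithLp 2 (H × H) :=
  WithLp.toLp 2 (-gradient f z.snd, z.fst)

theorem exists_lipschitzOnWith_phaseField {f : H → ℝ}
    (hf : ∀ B : Set H, Bornology.IsBounded B → ∃ K, LipschitzOnWith K (gradient f) B)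
    (S : Set (WithLp 2 (H × H))) (hS : Bornology.IsBounded S) :
    ∃ K, LipschitzOnWith K (phaseField f) S := by
  have h2 : LipschitzWith 1 (WithLp.snd : WithLp 2 (H × H) → H) :=
    LipschitzWith.mk_one WithLp.dist_snd_le
  have h1 : LipschitzWith 1 (WithLp.fst : WithLp 2 (H × H) → H) :=
    LipschitzWith.mk_one WithLp.dist_fst_le
  obtain ⟨K, hK⟩ := hf (WithLp.snd '' S) (h2.isBounded_image hS)
  exact ⟨_, ((hK.comp h2.lipschitzOnWith (mapsTo_image _ _)).neg).withLp_prodMk h1.lipschitzOnWith⟩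

theorem hasDerivAt_of_mem_subdifferential_phase {f φ : H → ℝ} {z : ℝ → WithLp 2 (H × H)} {t : ℝ}
    (hd : DifferentiableAt ℝ z t)
    (h : phaseField f (z t) - deriv z t ∈ subdifferential (phasePotential φ) (z t)) :
    HasDerivAt (fun s => (z s).fst) (deriv z t).fst t ∧
      HasDerivAt (fun s => (z s).snd) (z t).fst t ∧
      -gradient f (z t).snd - (deriv z t).fst ∈ subdifferential φ (z t).fst := by
  obtain ⟨h1, h2⟩ := mem_subdifferential_phasePotential.1 h
  have h3 : (z t).fst = (deriv z t).snd := sub_eq_zero.1 h2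
  exact ⟨hd.hasDerivAt.withLp_fst, h3 ▸ hd.hasDerivAt.withLp_snd, h1⟩

/-- The gradient is bounded on balls. This makes f absolutely continuous along Lipschitz
trajectories, as the energy estimate requires. -/
theorem Differentiable.lipschitzOnWith_closedBall_of_gradient {f : H → ℝ} (hf : Differentiable ℝ f)
    (hf_lip : ∀ B : Set H, Bornology.IsBounded B → ∃ K, LipschitzOnWith K (gradient f) B) (r : ℝ) :
    ∃ C, LipschitzOnWith C f (Metric.closedBall 0 r) := by
  obtain ⟨K, hK⟩ := hf_lip _ (Metric.isBounded_closedBall (x := (0 : H)) (r := r))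
  refine ⟨(‖gradient f 0‖ + K * r).toNNReal, Convex.lipschitzOnWith_of_nnnorm_fderiv_le (fun u _ => hf u) (fun u hu => ?_)
    (convex_closedBall 0 r)⟩
  have h1 : ‖gradient f u‖ = ‖fderiv ℝ f u‖ := by simp [gradient]
  rw [← NNReal.coe_le_coe, coe_nnnorm, ← h1]
  refine le_trans ?_ (Real.le_coe_toNNReal _)
  rw [mem_closedBall_zero_iff] at hu
  have h2 := hK.norm_sub_le (mem_closedBall_zero_iff.2 hu)
    (Metric.mem_closedBall_self ((norm_nonneg u).trans hu))
  rw [sub_zero] at h2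
  exact (norm_le_insert' _ (gradient f 0)).trans (by gcongr; exact h2.trans (by gcongr))

/-- The mechanical energy does not increase along solutions. -/
theorem IsSolutionOn.energy_le {f φ : H → ℝ} (hf : Differentiable ℝ f)
    (hf_lip : ∀ B : Set H, Bornology.IsBounded B → ∃ K, LipschitzOnWith K (gradient f) B)
    (hφ : ∀ u, 0 ≤ φ u) (hφ0 : φ 0 = 0) {z : ℝ → WithLp 2 (H × H)} {T : ℝ} (hT : 0 ≤ T)
    (hz : IsSolutionOn (phasePotential φ) (phaseField f) z T) :
    ‖(z T).fst‖ ^ 2 + 2 * f (z T).snd ≤ ‖(z 0).fst‖ ^ 2 + 2 * f (z 0).snd := by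
  obtain ⟨⟨L, hL⟩, hae⟩ := hz
  rw [← uIcc_of_le hT] at hL
  obtain ⟨r, hr⟩ := (isCompact_uIcc.image_of_continuousOn
    hL.withLp_snd.continuousOn).isBounded.subset_closedBall 0
  obtain ⟨C, hC⟩ := hf.lipschitzOnWith_closedBall_of_gradient hf_lip r
  have h1 := (hC.comp hL.withLp_snd (mapsTo_iff_image_subset.2 hr)).absolutelyContinuousOnInterval
  have h2 := hL.withLp_fst.absolutelyContinuousOnInterval_norm_sq.fun_add (h1.const_mul 2)
  have h3 := h2.sub_le_of_ae_deriv_le hT (c := 0) (by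
    filter_upwards [hae] with t ht htI
    obtain ⟨hv, hx, hsub⟩ := hasDerivAt_of_mem_subdifferential_phase (ht htI).1 (ht htI).2
    have e1 := ((hf (z t).snd).hasGradientAt.hasFDerivAt.comp_hasDerivAt t hx).const_mul (2 : ℝ)
    have e2 := hv.norm_sq.add e1
    have e3 : deriv (fun s => ‖(z s).fst‖ ^ 2 + 2 * (f ∘ fun s => (z s).snd) s) t = _ := e2.deriv
    rw [e3]
    -- With p = -∇f(x) - v' in ∂φ(v), testing at 0 gives ⟨p, v⟩ ≥ φ(v) ≥ 0, and the energy has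
    -- derivative -2⟨p, v⟩.
    have e4 := hsub 0
    rw [zero_sub, hφ0, inner_neg_right, inner_sub_left, inner_neg_left] at e4
    simp only [InnerProductSpace.toDual_apply_apply]
    rw [real_inner_comm]
    linarith [hφ (z t).fst])
  simp only [Function.comp] at h3
  linarith

/-- As f ≥ m, the energy bounds the speed by V at all times, and the position moves by at most V T.
-/
theorem IsSolutionOn.norm_le {f φ : H → ℝ} (hf : Differentiable ℝ f)
    (hf_lip : ∀ B : Set H, Bornology.IsBounded B → ∃ K, LipschitzOnWith K (gradient f) B)
    (hφ : ∀ u, 0 ≤ φ u) (hφ0 : φ 0 = 0) {m : ℝ} (hm : ∀ u, m ≤ f u) {z : ℝ → WithLp 2 (H × H)}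
    {T V : ℝ} (hT : 0 ≤ T) (hV : 0 ≤ V) (hV2 : ‖(z 0).fst‖ ^ 2 + 2 * (f (z 0).snd - m) ≤ V ^ 2)
    (hz : IsSolutionOn (phasePotential φ) (phaseField f) z T) :
    ‖z T‖ ≤ V + (‖(z 0).snd‖ + V * T) := by
  have hv : ∀ t ∈ Icc 0 T, ‖(z t).fst‖ ≤ V := fun t ht => by
    have h1 := (hz.mono ht.2).energy_le hf hf_lip hφ hφ0 ht.1
    refine le_of_sq_le_sq ?_ hV
    linarith [hm (z t).snd]
  obtain ⟨⟨L, hL⟩, hae⟩ := hz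
  have hx := hL.withLp_snd.norm_sub_le_of_ae_norm_deriv_le hT hV (by
    filter_upwards [hae] with t ht htI
    obtain ⟨-, hx, -⟩ := hasDerivAt_of_mem_subdifferential_phase (ht htI).1 (ht htI).2
    exact ⟨hx.differentiableAt, hx.deriv ▸ hv t (Ioo_subset_Icc_self htI)⟩)
  refine (norm_le_norm_fst_add_norm_snd _).trans (add_le_add (hv T (right_mem_Icc.2 hT)) ?_)
  rw [sub_zero] at hx
  linarith [norm_le_insert' (z T).snd (z 0).snd]

/-- The position of a global solution of the first-order system is `C¹`. -/
theorem phase_position {f φ : H → ℝ} {z : ℝ → WithLp 2 (H × H)}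
    (hz : ∀ T, IsSolutionOn (phasePotential φ) (phaseField f) z T) :
    ContDiffOn ℝ 1 (fun t => (z t).snd) (Ici 0) ∧
      EqOn (velocity fun t => (z t).snd) (fun t => (z t).fst) (Ici 0) := by
  have hlip : ∀ a b, ∃ L, LipschitzOnWith L (fun t => (z (max t 0)).fst) (uIcc a b) := fun a b => by
    obtain ⟨L, hL⟩ := (hz (max (max a b) 0)).1
    refine ⟨L * 1, hL.withLp_fst.comp (LipschitzWith.id.max_const 0).lipschitzOnWith
      fun t ht => ⟨le_max_right _ _, ?_⟩⟩
    exact max_le_max_right _ ht.2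
  have hcont : Continuous fun t => (z (max t 0)).fst := continuous_iff_continuousAt.2 fun t => by
    obtain ⟨L, hL⟩ := hlip (t - 1) (t + 1)
    refine hL.continuousOn.continuousAt ?_
    rw [uIcc_of_le (by linarith)]
    exact Icc_mem_nhds (by linarith) (by linarith)
  let I : ℝ → H := fun t => (z 0).snd + ∫ s in (0 : ℝ)..t, (z (max s 0)).fst
  have hI : ∀ t, HasDerivAt I (z (max t 0)).fst t := fun t =>
    (intervalIntegral.integral_hasDerivAt_right (hcont.intervalIntegrable _ _)
      (hcont.stronglyMeasurableAtFilter _ _) hcont.continuousAt).const_add _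
  have hI1 : ContDiff ℝ 1 I := by
    refine contDiff_one_iff_deriv.2 ⟨fun t => (hI t).differentiableAt, ?_⟩
    rw [show deriv I = _ from funext fun t => (hI t).deriv]
    exact hcont
  -- The difference is absolutely continuous with a.e. zero derivative, so the a.e. equation x' = v
  -- holds everywhere, with v continuous.
  have heq : EqOn (fun t => (z t).snd) I (Ici 0) := by
    intro T hT
    obtain ⟨⟨L, hL⟩, hae⟩ := hz T
    rw [← uIcc_of_le (mem_Ici.1 hT)] at hL
    have hac := hL.withLp_snd.absolutelyContinuousOnInterval.fun_sub
      (hI1.contDiffOn.absolutelyContinuousOnInterval (a := 0) (b := T))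
    have h0 : ∀ᵐ t : ℝ, t ≠ 0 := by simp [ae_iff, measure_singleton]
    have hT' : ∀ᵐ t : ℝ, t ≠ T := by simp [ae_iff, measure_singleton]
    obtain ⟨C, hC⟩ := hac.const_of_ae_hasDerivAt_zero (by
      filter_upwards [hae, h0, hT'] with t ht ht0 htT htI
      rw [uIcc_of_le (mem_Ici.1 hT)] at htI
      have htI' : t ∈ Ioo 0 T := ⟨lt_of_le_of_ne htI.1 ht0.symm, lt_of_le_of_ne htI.2 htT⟩
      obtain ⟨-, hx, -⟩ := hasDerivAt_of_mem_subdifferential_phase (ht htI').1 (ht htI').2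
      have h := hx.sub (hI t)
      rw [max_eq_left htI.1, sub_self] at h
      exact h)
    have e1 := hC 0 left_mem_uIcc
    have e2 := hC T right_mem_uIcc
    have e3 : I 0 = (z 0).snd := by simp [I]
    rw [e3, sub_self] at e1
    rw [← e1] at e2
    exact sub_eq_zero.1 e2
  refine ⟨hI1.contDiffOn.congr heq, fun t ht => ?_⟩
  have h1 := ((hI t).hasDerivWithinAt (s := Ici 0)).congr heq (heq ht)
  rw [max_eq_left (mem_Ici.1 ht)] at h1
  exact h1.derivWithin (uniqueDiffOn_Ici 0 t ht)

theorem isStrongGlobalSolution_of_phase {f φ : H → ℝ} {z : ℝ → WithLp 2 (H × H)}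
    (hz : ∀ T, IsSolutionOn (phasePotential φ) (phaseField f) z T) :
    IsStrongGlobalSolution φ f fun t => (z t).snd := by
  obtain ⟨hC, hvel⟩ := phase_position hz
  have hlip : ∀ T, ∃ L, LipschitzOnWith L (velocity fun t => (z t).snd) (Icc 0 T) := fun T => by
    obtain ⟨L, hL⟩ := (hz T).1
    refine ⟨L, fun s hs t ht => ?_⟩
    rw [hvel (mem_Ici.2 hs.1), hvel (mem_Ici.2 ht.1)]
    exact hL.withLp_fst hs ht
  refine ⟨hC, fun T _ => hlip T, fun T _ => ?_, ?_⟩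
  · obtain ⟨L, hL⟩ := hlip T
    refine MemLp.of_bound (stronglyMeasurable_deriv _).aestronglyMeasurable L ?_
    refine (ae_restrict_iff' measurableSet_Ioo).2 (ae_of_all _ fun t ht => ?_)
    exact norm_deriv_le_of_lipschitzOn (Icc_mem_nhds ht.1 ht.2) hL
  · rw [ae_restrict_iff' measurableSet_Ioi]
    filter_upwards [ae_all_iff.2 fun n : ℕ => (hz n).2] with t ht htpos
    obtain ⟨n, hn⟩ := exists_nat_gt t
    obtain ⟨hd, hsub⟩ := ht n ⟨htpos, hn⟩
    obtain ⟨hv, -, hp⟩ := hasDerivAt_of_mem_subdifferential_phase hd hsub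
    have hev : (velocity fun t => (z t).snd) =ᶠ[nhds t] fun t => (z t).fst := by
      filter_upwards [Ioi_mem_nhds htpos] with s hs
      exact hvel (Ioi_subset_Ici_self hs)
    have hv' := hv.congr_of_eventuallyEq hev
    refine ⟨hv'.differentiableAt, ?_⟩
    rw [acceleration, hv'.deriv, hev.eq_of_nhds]
    refine mem_add.2 ⟨_, add_mem_add rfl hp, _, rfl, ?_⟩
    abel

/-- The converse passage to phase space transfers uniqueness to the second-order problem. -/
theorem IsStrongGlobalSolution.isSolutionOn {f φ : H → ℝ} {y : ℝ → H}
    (hy : IsStrongGlobalSolution φ f y) {T : ℝ} (hT : 0 < T) :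
    IsSolutionOn (phasePotential φ) (phaseField f) (fun t => WithLp.toLp 2 (velocity y t, y t))
      T := by
  obtain ⟨L₁, hL₁⟩ := hy.lipschitz_velocity T hT
  obtain ⟨L₂, hL₂⟩ := (hy.contDiffOn.mono Icc_subset_Ici_self).exists_lipschitzOnWith one_ne_zero
    (convex_Icc 0 T) isCompact_Icc
  refine ⟨⟨_, hL₁.withLp_prodMk hL₂⟩, ?_⟩
  have hinc := hy.inclusion
  rw [ae_restrict_iff' measurableSet_Ioi] at hinc
  filter_upwards [hinc] with t ht htT
  obtain ⟨hd, hsub⟩ := ht htT.1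
  have hx : HasDerivAt y (velocity y t) t :=
    ((hy.contDiffOn.differentiableOn one_ne_zero) t (mem_Ici.2 htT.1.le)).hasDerivWithinAt.hasDerivAt
      (Ici_mem_nhds htT.1)
  have hz := hd.hasDerivAt.withLp_prodMk hx
  refine ⟨hz.differentiableAt, ?_⟩
  rw [hz.deriv, mem_subdifferential_phasePotential]
  refine ⟨?_, sub_self _⟩
  obtain ⟨_, ⟨a, rfl, p, hp, rfl⟩, g, rfl, hsum⟩ := hsub
  change -gradient f (y t) - acceleration y t ∈ subdifferential φ (velocity y t)
  convert hp using 1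
  have : acceleration y t + p + gradient f (y t) = 0 := hsum
  rw [← sub_eq_zero, ← neg_eq_zero, ← this]
  abel

end

/-! ### Existence and uniqueness. -/

theorem mainTheorem1 {H : Type*} [NormedAddCommGroup H] [InnerProductSpace ℝ H] [CompleteSpace H]
    (f φ : H → ℝ) (hf : Differentiable ℝ f)
    (hf_lip : ∀ B : Set H, Bornology.IsBounded B → ∃ K, LipschitzOnWith K (gradient f) B)
    (hf_bdd : BddBelow (Set.range f)) (hφ : IsDampingPotential φ) (x₀ x₁ : H) :
    ∃ x : ℝ → H,
      (IsStrongGlobalSolution φ f x ∧ x 0 = x₀ ∧ velocity x 0 = x₁) ∧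
      ∀ y : ℝ → H, IsStrongGlobalSolution φ f y → y 0 = x₀ → velocity y 0 = x₁ →
        Set.EqOn y x (Set.Ici 0) := by
  obtain ⟨m, hm⟩ := hf_bdd
  replace hm : ∀ u, m ≤ f u := fun u => hm (mem_range_self u)
  set z₀ : WithLp 2 (H × H) := WithLp.toLp 2 (x₁, x₀)
  have hB := exists_lipschitzOnWith_phaseField hf_lip
  -- The speed bound given by the initial energy.
  set V := Real.sqrt (‖x₁‖ ^ 2 + 2 * (f x₀ - m)) with hV
  have hV2 : ‖x₁‖ ^ 2 + 2 * (f x₀ - m) ≤ V ^ 2 := by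
    rw [Real.sq_sqrt]
    nlinarith [hm x₀, sq_nonneg ‖x₁‖]
  obtain ⟨z, hz0, hz⟩ := exists_global_solution (Ψ := phasePotential φ) (B := phaseField f)
    (q := fun u => WithLp.toLp 2 (minimalSection φ u.fst, 0)) hB
    (fun u => mem_subdifferential_phasePotential.2
      ⟨(minimalSection_spec hφ.convex hφ.continuous u.fst).1, rfl⟩)
    (fun R hR => by
      obtain ⟨M, hM⟩ := hφ.minimalSection_bounded R hR
      refine ⟨M, fun u hu => ?_⟩
      rw [WithLp.norm_toLp_fst]
      exact hM _ ((WithLp.norm_fst_le _ _).trans hu))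
    z₀ (fun T hT => ⟨V + (‖x₀‖ + V * T), fun t ht z hz hz0 => by
      have h1 := hz.norm_le hf hf_lip hφ.nonneg hφ.map_zero hm ht.1 (Real.sqrt_nonneg _)
        (by rw [hz0]; exact hV2)
      rw [hz0] at h1
      refine h1.trans ?_
      have h2 := mul_le_mul_of_nonneg_left ht.2 (Real.sqrt_nonneg (‖x₁‖ ^ 2 + 2 * (f x₀ - m)))
      rw [← hV] at h2 ⊢
      change V + (‖x₀‖ + V * t) ≤ _
      linarith⟩)
  refine ⟨fun t => (z t).snd, ⟨isStrongGlobalSolution_of_phase hz, congrArg WithLp.snd hz0, ?_⟩, ?_⟩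
  · exact ((phase_position hz).2 self_mem_Ici).trans (congrArg WithLp.fst hz0)
  · intro y hy hy0 hy1 t ht
    -- The horizon t + 1 is positive even when t = 0.
    have h1 := (hy.isSolutionOn (T := t + 1) (by linarith [mem_Ici.1 ht])).unique hB (hz (t + 1))
      (by rw [hz0, hy0, hy1]) ⟨ht, by linarith⟩
    exact congrArg WithLp.snd h1
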